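/- **Existence of a Nash equilibrium for the APT vs. DIFT game.** *Data.* Let $\mathcal G=(V,E)$ be a finite directed graph (the information flow graph), $\lambda\subseteq V$ a set of entry points and $\mathcal D\subseteq V$ a set of destinations, with $\lambda\cap\mathcal D=\emptyset$. There are $W$ tagged flows, exactly one of which is malicious. Its index $m\in\{1,\dots,W\}$ is drawn at the start from a given distribution $\rho$; the adversary (APT) knows $m$, while the defender (DIFT) is not told $m$. Further data are rates $FN,FP\in[0,1]$, costs $\mathcal C_D(v)<0$ $(v\in V)$, rewards and penalties $\alpha_D>0>\beta_D$ and $\beta_A>0>\alpha_A$, a benign flow distribution $\pi_B$ that gives for each node $v$ a probability distribution on $\{\phi\}\cup\{w:(v,w)\in E\}$, and a time horizon $T\in\{0,1,2,\dots\}\cup\{\infty\}$. *States.* A state is $s=(x,v_1,\dots,v_W)$, where $x\in\{A,D\}$ is the player who moves and each $v_k$ is either the source $s_F$, a node of $V$, $\phi$ (dropped out) or $\tau$ (trapped). The initial state is $s_0=(A,s_F,\dots,s_F)$. A state is absorbing if $v_m\in\mathcal D$, or $v_k=\tau$ for some $k$, or $v_k=\phi$ for all $k$. The game is over as soon as the state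 is absorbing or the time is $T$. *Moves.* In a state with $x=A$ the adversary either drops the malicious flow ($\phi$) or moves it to a node that it has not visited before: an element of $\lambda$ from $s_F$, an out-neighbor of $v_m$ from $v_m\in V$; a dropped flow stays dropped. Simultaneously the benign flows move at random, with a given joint law depending on $m$, the current locations and the adversary's action, such that a dropped flow stays dropped and a benign flow at a node $v$ moves to (or drops out into) a value that has positive $\pi_B(v)$-probability; the nodes at which the benign flows first arrive are unrestricted. (Independent moves, or moves conditioned on the flows being at distinct nodes, are special cases.) Then $x$ becomes $D$. In a state with $x=D$ the defender either does nothing ($0$) or analyzes one flow $k$ that is at a node $v_k\in V\setminus\lambda$. If $k=m$ the flow is trapped ($v_k$ becomes $\tau$) with probability $1-FN$; if $k\ne m$ it is trapped with probability $FP$; otherwise the locations are unchanged. Then $x$ becomes $A$. *Strategies.* A behavioral strategy of the defender assigns to every sequence consisting of the past states, the defender's own past actions and the present state a probability distribution on the actions admissible for the defender. A behavioral strategy of the adversary does the same with the past states, the adversary's own past actions, the present state, and $m$. *Payoffs.* Each analysis of a flow at a node $v$ adds $\mathcal C_D(v)$ to the defender's payoff. When the game is over, player $X\in\{A,D\}$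 receives $\alpha_X$ if the malicious flow is trapped, $\beta_X$ if the malicious flow is at a destination or a benign flow is trapped, and $0$ otherwise. $U_X(p_D,p_A)=\sum_{t}\mathbb E[R^X_t]$ is the expected total payoff, where $R^X_t$ is what player $X$ receives at time $t$. *Proposition.* Suppose that $T$ is finite, or that benign flows cannot cycle, i.e. the graph $\{(v,w):\pi_B(v)(w)>0\}$ is acyclic (for instance because $\mathcal G$ is acyclic). Then the sums defining $U_D$ and $U_A$ converge absolutely for all pairs of behavioral strategies, and there is a Nash equilibrium in behavioral strategies: a pair $(p_D,p_A)$ with $U_D(q_D,p_A)\le U_D(p_D,p_A)$ for every behavioral strategy $q_D$ of the defender and $U_A(p_D,q_A)\le U_A(p_D,p_A)$ for every behavioral strategy $q_A$ of the adversary. -/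

import Mathlib

open scoped NNReal ENNReal

namespace AptDift

/-- Location of a tagged flow: the source `s_F` of the flow network, a node of the information flow
graph, dropped out (`φ`), or trapped by the defender (`τ`). -/
inductive Loc (V : Type*)
  | source
  | node (v : V)
  | dropped
  | trapped

/-- The two players, DIFT and APT. -/
inductive Player
  | defender
  | adversary

/-- A state `(x, v₁, …, v_W)`: the player who controls it and the locations of the `W` flows. -/
structure State (V : Type*) (W : ℕ) where
  turn : Player
  loc : Fin W → Loc V

/-- The initial state `(A, s_F, …, s_F)`. -/
def State.init (V : Type*) (W : ℕ) : State V W := ⟨Player.adversary, fun _ => Loc.source⟩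

/-- A move of a flow: `some w` is a transition to the node `w`, `none` is dropping out. -/
def Loc.ofMove {V : Type*} : Option V → Loc V
  | some w => Loc.node w
  | none => Loc.dropped

/-- The data of an APT vs. DIFT game on an information flow graph with node set `V` and `W` tagged
flows, exactly one of which is malicious. -/
structure Game (V : Type*) (W : ℕ) where
  /-- edges of the information flow graph -/
  edge : V → V → Prop
  /-- entry points `λ` -/
  entry : Set V
  /-- destinations `𝒟` -/
  dest : Set V
  entry_disjoint_dest : Disjoint entry dest
  /-- Distribution of the index of the malicious flow. The index is known to the adversary and is
  not revealed to the defender. -/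
  prior : PMF (Fin W)
  /-- Benign flow distribution `π_B`: where a benign flow goes from the node `v`. -/
  piB : V → PMF (Option V)
  piB_edge : ∀ v w, some w ∈ (piB v).support → edge v w
  /-- Joint law of the next moves of the benign flows, given the malicious index `m`, the current
  locations and the adversary's move; its `m`-th coordinate is not used. Any joint law that is
  compatible with `π_B` is allowed: independent moves, moves conditioned on the flows
  arriving at distinct nodes, other couplings. The nodes at which the benign flows first arrive are
  unrestricted. -/
  benign : Fin W → (Fin W → Loc V) → Option V → PMF (Fin W → Option V)
  benign_dropped : ∀ m l a, ∀ z ∈ (benign m l a).support, ∀ k, k ≠ m →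
    l k = Loc.dropped → z k = none
  benign_node : ∀ m l a, ∀ z ∈ (benign m l a).support, ∀ k, k ≠ m →
    ∀ v, l k = Loc.node v → z k ∈ (piB v).support
  /-- false-negative rate -/
  FN : ℝ≥0
  FN_le_one : FN ≤ 1
  /-- false-positive rate -/
  FP : ℝ≥0
  FP_le_one : FP ≤ 1
  /-- resource cost of security analysis at a node -/
  costD : V → ℝ
  costD_neg : ∀ v, costD v < 0
  alphaD : ℝ
  alphaD_pos : 0 < alphaD
  betaD : ℝ
  betaD_neg : betaD < 0
  alphaA : ℝ
  alphaA_neg : alphaA < 0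
  betaA : ℝ
  betaA_pos : 0 < betaA

/-- A history of play: the malicious index, then all actions and states in chronological order.
The initial state `s₀` is `State.init`. -/
inductive History (V : Type*) (W : ℕ)
  | start (m : Fin W)
  | advMove (h : History V W) (a : Option V) (s : State V W)
  | defMove (h : History V W) (d : Option (Fin W)) (s : State V W)

/-- Information `Y_t` of the defender: the states after `s₀`, each preceded by the defender's own
action when the defender moved (`none` when the adversary moved); most recent first. A defender
action is `none` (no analysis) or `some k` (analyse flow `k`). -/
abbrev DefInfo (V : Type*) (W : ℕ) := List (Option (Option (Fin W)) × State V W)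

/-- Information `Z_t` of the adversary: the malicious index and the states after `s₀`, each preceded
by the adversary's own action when the adversary moved (`none` when the defender moved); most
recent first. An adversary action is `none` (drop out) or `some w` (go to the node `w`). -/
structure AdvInfo (V : Type*) (W : ℕ) where
  label : Fin W
  record : List (Option (Option V) × State V W)

namespace History

variable {V : Type*} {W : ℕ}

/-- index of the malicious flow -/
def label : History V W → Fin W
  | start m => m
  | advMove h _ _ => h.label
  | defMove h _ _ => h.label

/-- current state -/
def state : History V W → State V W
  | start _ => State.init V W
  | advMove _ _ s => s
  | defMove _ _ s => s

/-- number of steps played -/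
def length : History V W → ℕ
  | start _ => 0
  | advMove h _ _ => h.length + 1
  | defMove h _ _ => h.length + 1

/-- what the defender knows -/
def defInfo : History V W → DefInfo V W
  | start _ => []
  | advMove h _ s => (none, s) :: h.defInfo
  | defMove h d s => (some d, s) :: h.defInfo

/-- the adversary's record of states and own actions -/
def advRecord : History V W → List (Option (Option V) × State V W)
  | start _ => []
  | advMove h a s => (some a, s) :: h.advRecord
  | defMove h _ s => (none, s) :: h.advRecord

/-- what the adversary knows -/
def advInfo (h : History V W) : AdvInfo V W := ⟨h.label, h.advRecord⟩

end History

/-- The current state recorded in a list of (own action, state) pairs, most recent first. -/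
def currentState {V : Type*} {W : ℕ} {α : Type*} : List (α × State V W) → State V W
  | [] => State.init V W
  | e :: _ => e.2

/-- Expectation of a real function under a discrete law. -/
noncomputable def expect {α : Type*} (p : PMF α) (f : α → ℝ) : ℝ := ∑' a, (p a).toReal * f a

/-- The law on `Bool` giving `true` probability `p` and `false` probability `1 - p`. -/
noncomputable def coin (p : ℝ≥0) (hp : p ≤ 1) : PMF Bool :=
  PMF.ofFintype (fun b => ((if b then p else 1 - p : ℝ≥0) : ℝ≥0∞)) (by
    rw [Fintype.sum_bool, ← ENNReal.coe_add]
    simp [add_tsub_cancel_of_le hp])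

namespace Game

variable {V : Type*} {W : ℕ} (G : Game V W)

/-- Out-neighbours in the flow network (without its sink): the source leads to the entry points. -/
def Succ : Loc V → V → Prop
  | Loc.source, w => w ∈ G.entry
  | Loc.node v, w => G.edge v w
  | Loc.dropped, _ => False
  | Loc.trapped, _ => False

/-- Admissible adversary actions: drop the flow, or move it along an edge to a node that it has not
visited (the malicious flow follows a simple path). A dropped flow stays dropped. -/
def advActions (z : AdvInfo V W) : Set (Option V) :=
  {a | ∀ w, a = some w → G.Succ ((currentState z.record).loc z.label) w ∧
    ∀ e ∈ z.record, e.2.loc z.label ≠ Loc.node w}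

/-- Admissible defender actions: no analysis, or analyse a flow that is at a node outside `λ`. -/
def defActions (y : DefInfo V W) : Set (Option (Fin W)) :=
  {d | ∀ k, d = some k → ∃ v, (currentState y).loc k = Loc.node v ∧ v ∉ G.entry}

/-- Behavioral strategies of the defender. -/
structure DefStrategy where
  prob : DefInfo V W → PMF (Option (Fin W))
  admissible : ∀ y, (prob y).support ⊆ G.defActions y

/-- Behavioral strategies of the adversary. -/
structure AdvStrategy where
  prob : AdvInfo V W → PMF (Option V)
  admissible : ∀ z, (prob z).support ⊆ G.advActions z

/-- Absorbing states: the malicious flow `m` is at a destination, or some flow is trapped, or all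
flows have dropped out. -/
def Absorbing (m : Fin W) (s : State V W) : Prop :=
  (∃ v ∈ G.dest, s.loc m = Loc.node v) ∨ (∃ k, s.loc k = Loc.trapped) ∨
    ∀ k, s.loc k = Loc.dropped

open scoped Classical in
/-- Transition at an adversary-controlled state under the adversary action `a`. -/
noncomputable def advTrans (m : Fin W) (s : State V W) (a : Option V) : PMF (State V W) :=
  (G.benign m s.loc a).map fun z =>
    ⟨Player.defender, fun k => Loc.ofMove (if k = m then a else z k)⟩

/-- The probability that analysing flow `k` traps it: `1 - FN` for the malicious flow, `FP` for a
benign one. -/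
noncomputable def trapProb (m k : Fin W) : ℝ≥0 := if k = m then 1 - G.FN else G.FP

theorem trapProb_le_one (m k : Fin W) : G.trapProb m k ≤ 1 := by
  unfold trapProb
  split
  · exact tsub_le_self
  · exact G.FP_le_one

/-- Transition at a defender-controlled state under the defender action `d`. -/
noncomputable def defTrans (m : Fin W) (s : State V W) : Option (Fin W) → PMF (State V W)
  | none => PMF.pure ⟨Player.adversary, s.loc⟩
  | some k => (coin (G.trapProb m k) (G.trapProb_le_one m k)).map fun b =>
      ⟨Player.adversary, if b then Function.update s.loc k Loc.trapped else s.loc⟩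

variable {G}

/-- One step of play after the history `h`. -/
noncomputable def next (pD : G.DefStrategy) (pA : G.AdvStrategy) (h : History V W) :
    PMF (History V W) :=
  match h.state.turn with
  | Player.adversary => (pA.prob h.advInfo).bind fun a =>
      (G.advTrans h.label h.state a).map fun s => History.advMove h a s
  | Player.defender => (pD.prob h.defInfo).bind fun d =>
      (G.defTrans h.label h.state d).map fun s => History.defMove h d s

/-- With time horizon `T`, the game is over after the history `h`. -/
def Over (G : Game V W) (T : ℕ∞) (h : History V W) : Prop :=
  G.Absorbing h.label h.state ∨ T ≤ (h.length : ℕ∞)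

open scoped Classical in
/-- Law of the history at time `t`; the play is frozen once the game is over. -/
noncomputable def law (T : ℕ∞) (pD : G.DefStrategy) (pA : G.AdvStrategy) :
    ℕ → PMF (History V W)
  | 0 => G.prior.map History.start
  | t + 1 => (law T pD pA t).bind fun h =>
      if G.Over T h then PMF.pure h else next pD pA h

open scoped Classical in
/-- Payoff at the end of the game: `α` if the malicious flow is trapped, `β` if it has reached a
destination or a benign flow is trapped, and `0` otherwise. -/
noncomputable def endPayoff (G : Game V W) (α β : ℝ) (m : Fin W) (s : State V W) : ℝ :=
  if s.loc m = Loc.trapped then α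
  else if (∃ v ∈ G.dest, s.loc m = Loc.node v) ∨ ∃ k, s.loc k = Loc.trapped then β
  else 0

/-- Resource cost of a defender action at a state. -/
def actionCost (G : Game V W) (s : State V W) : Option (Fin W) → ℝ
  | none => 0
  | some k => match s.loc k with
    | Loc.node v => G.costD v
    | _ => 0

open scoped Classical in
/-- Expected payoff `E[R_t]` of the defender at time `t`. Histories of length less than `t` belong
to games that were over before `t`. -/
noncomputable def stageD (T : ℕ∞) (pD : G.DefStrategy) (pA : G.AdvStrategy) (t : ℕ) : ℝ :=
  expect (law T pD pA t) fun h =>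
    if h.length = t then
      if G.Over T h then G.endPayoff G.alphaD G.betaD h.label h.state
      else match h.state.turn with
        | Player.defender => expect (pD.prob h.defInfo) (G.actionCost h.state)
        | Player.adversary => 0
    else 0

open scoped Classical in
/-- Expected payoff `E[R_t]` of the adversary at time `t`. -/
noncomputable def stageA (T : ℕ∞) (pD : G.DefStrategy) (pA : G.AdvStrategy) (t : ℕ) : ℝ :=
  expect (law T pD pA t) fun h =>
    if h.length = t ∧ G.Over T h then G.endPayoff G.alphaA G.betaA h.label h.state else 0

/-- Expected total payoff `U_D` of the defender. -/
noncomputable def payoffD (T : ℕ∞) (pD : G.DefStrategy) (pA : G.AdvStrategy) : ℝ :=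
  ∑' t, stageD T pD pA t

/-- Expected total payoff `U_A` of the adversary. -/
noncomputable def payoffA (T : ℕ∞) (pD : G.DefStrategy) (pA : G.AdvStrategy) : ℝ :=
  ∑' t, stageA T pD pA t

/-- Best responses of the defender. -/
def bestD (T : ℕ∞) (pA : G.AdvStrategy) : Set G.DefStrategy :=
  {pD | ∀ qD : G.DefStrategy, payoffD T qD pA ≤ payoffD T pD pA}

/-- Best responses of the adversary. -/
def bestA (T : ℕ∞) (pD : G.DefStrategy) : Set G.AdvStrategy :=
  {pA | ∀ qA : G.AdvStrategy, payoffA T pD qA ≤ payoffA T pD pA}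

/-- Nash equilibrium in behavioral strategies. -/
def IsNash (T : ℕ∞) (pD : G.DefStrategy) (pA : G.AdvStrategy) : Prop :=
  pD ∈ bestD T pA ∧ pA ∈ bestA T pD

/-- Benign flows never run in a cycle: the graph of the transitions that have positive probability
under `π_B` is acyclic. This holds whenever the information flow graph is acyclic. -/
def BenignAcyclic (G : Game V W) : Prop :=
  ∀ v, ¬ Relation.TransGen (fun u w => some w ∈ (G.piB u).support) v v

end Game

end AptDift

/-! The length of a play is bounded uniformly in the strategies: by `T`, or, without benign cycles,
because a nonnegative integer potential drops at every adversary move (`exists_length_bound`). Hence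
only finitely many stage payoffs are nonzero.

Both players have perfect recall, so the probability of a history is a chance factor times one
factor for each player, the probability `reach` that this player makes the choices recorded in it.
In these coordinates (the sequence form) the payoffs are bilinear: `hasRep_law`,
`exists_sum_stageD`, `exists_sum_stageA`. The possible `reach` functions are exactly those that
satisfy the linear constraints `IsPlan`; they form a compact convex set, and behavioral strategies
can be recovered from them (`IsPlan.exists_reach_eq`).

What remains is a bilinear two-player game on compact convex sets (`exists_bilinear_equilibrium`).
The payoffs have finite rank, so the strategy sets can be mapped to a Euclidean space, where an
equilibrium is a solution of a variational inequality and thus a fixed point of a projected map.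
Brouwer's theorem is proved by the volume argument of Milnor and Rogers. -/

namespace AptDift

/-! ### No smooth retraction of the ball onto its sphere. -/

section Brouwer

open MeasureTheory Metric Set Topology

variable {E : Type*} [NormedAddCommGroup E] [InnerProductSpace ℝ E] [FiniteDimensional ℝ E]

/-- Along a line through the identity the determinant is a polynomial. -/
theorem exists_polynomial_det_one_add_smul (A : E →L[ℝ] E) :
    ∃ p : Polynomial ℝ, p.natDegree ≤ Module.finrank ℝ E ∧
      ∀ t : ℝ, (1 + t • A).det = p.eval t := by
  classical
  let b := Module.finBasis ℝ E
  let M := LinearMap.toMatrix b b A.toLinearMap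
  refine ⟨Matrix.det ((Polynomial.X : Polynomial ℝ) • M.map Polynomial.C
    + (1 : Matrix _ _ ℝ).map Polynomial.C), ?_, fun t => ?_⟩
  · simpa using Polynomial.natDegree_det_X_add_C_le M 1
  · rw [ContinuousLinearMap.det, ← LinearMap.det_toMatrix b, ← Polynomial.coe_evalRingHom,
      RingHom.map_det]
    congr 1
    ext i j
    simp [M, Matrix.one_apply, LinearMap.toMatrix_apply, Finsupp.single_apply, add_comm,
      apply_ite (Polynomial.eval t), eq_comm]
    ring

/-- Extrapolation to `1` of polynomials of bounded degree from sample points near `0`. -/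
theorem exists_extrapolation (n : ℕ) {ε : ℝ} (hε : 0 < ε) :
    ∃ (s : Finset ℝ) (w : ℝ → ℝ), (∀ t ∈ s, 0 < t ∧ t < ε) ∧
      ∀ p : Polynomial ℝ, p.natDegree ≤ n → p.eval 1 = ∑ t ∈ s, w t * p.eval t := by
  obtain ⟨s, hs, hcard⟩ := (Set.Ioo_infinite hε).exists_subset_card_eq (n + 1)
  -- Lagrange interpolation at `n + 1` nodes; the weights do not depend on the polynomial.
  refine ⟨s, fun t => (Lagrange.basis s id t).eval 1, fun t ht => hs ht, fun p hp => ?_⟩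
  have hdeg : p.degree < s.card := by
    rw [hcard]
    exact lt_of_le_of_lt Polynomial.degree_le_natDegree (by exact_mod_cast Nat.lt_succ_of_le hp)
  conv_lhs => rw [Lagrange.eq_interpolate (v := id) (Set.injOn_id _) hdeg]
  rw [Lagrange.interpolate_apply, Polynomial.eval_finsetSum]
  refine Finset.sum_congr rfl fun t _ => ?_
  simp [mul_comm]

omit [FiniteDimensional ℝ E] in
/-- A map that is Lipschitz on the closed unit ball and vanishes on the sphere stays Lipschitz when
extended by zero. -/
theorem lipschitzWith_indicator_closedBall {C : ℝ≥0} {g : E → E}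
    (hg : LipschitzOnWith C g (closedBall 0 1)) (h0 : ∀ x ∈ sphere (0 : E) 1, g x = 0) :
    LipschitzWith C ((closedBall 0 1).indicator g) := by
  classical
  -- The segment from `x` to `y` meets the sphere at a point where `g` vanishes and which is no
  -- farther from `x` than `y` is.
  have key : ∀ x ∈ closedBall (0 : E) 1, ∀ y ∉ closedBall (0 : E) 1, ‖g x‖ ≤ C * dist x y := by
    intro x hx y hy
    have hcont : ContinuousOn (fun t : ℝ => ‖AffineMap.lineMap (k := ℝ) x y t‖) (Icc 0 1) := by
      have : Continuous fun t : ℝ => AffineMap.lineMap (k := ℝ) x y t :=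
        AffineMap.lineMap_continuous
      fun_prop
    simp only [mem_closedBall, dist_zero_right, not_le] at hx hy
    obtain ⟨t, ht, hz⟩ := intermediate_value_Icc zero_le_one hcont
      (show (1 : ℝ) ∈ Icc _ _ by simpa using ⟨hx, hy.le⟩)
    have hzs : AffineMap.lineMap (k := ℝ) x y t ∈ sphere (0 : E) 1 := by simpa using hz
    have := hg.dist_le_mul x (by simpa using hx) _ (sphere_subset_closedBall hzs)
    rw [h0 _ hzs, dist_zero_right, dist_left_lineMap] at this
    refine this.trans (mul_le_mul_of_nonneg_left ?_ C.2)
    rw [Real.norm_of_nonneg ht.1]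
    exact mul_le_of_le_one_left dist_nonneg ht.2
  refine LipschitzWith.of_dist_le_mul fun x y => ?_
  by_cases hx : x ∈ closedBall (0 : E) 1 <;> by_cases hy : y ∈ closedBall (0 : E) 1
  · rw [indicator_of_mem hx, indicator_of_mem hy]; exact hg.dist_le_mul x hx y hy
  · rw [indicator_of_mem hx, indicator_of_notMem hy, dist_zero_right]; exact key x hx y hy
  · rw [indicator_of_mem hy, indicator_of_notMem hx, dist_zero_left, dist_comm]; exact key y hy x hx
  · rw [indicator_of_notMem hx, indicator_of_notMem hy, dist_self]; positivity

/-- A small Lipschitz perturbation of the identity that is supported in a set `s` permutes `s`. -/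
theorem bijOn_add_of_lipschitz {K : ℝ≥0} (hK : K < 1) {G : E → E} (hG : LipschitzWith K G)
    {s : Set E} (hs : ∀ x ∉ s, G x = 0) : BijOn (fun x => x + G x) s s := by
  have hinj : Function.Injective fun x => x + G x := by
    intro x y hxy
    have h1 : x - y = G y - G x := by
      have : x + G x = y + G y := hxy
      rw [sub_eq_sub_iff_add_eq_add, this, add_comm]
    have h2 : ‖x - y‖ ≤ K * ‖x - y‖ := by
      conv_lhs => rw [h1]
      rw [norm_sub_rev x y]
      exact hG.norm_sub_le y x
    have h3 : (K : ℝ) < 1 := hK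
    have : ‖x - y‖ = 0 := by nlinarith [norm_nonneg (x - y)]
    exact sub_eq_zero.1 (norm_eq_zero.1 this)
  refine ⟨fun x hx => ?_, hinj.injOn, fun y hy => ?_⟩
  -- If the image of `x` lay outside `s`, it would be a fixed point of the map, hence equal to `x`
  -- by injectivity.
  · by_contra hn
    have : x + G x = x := hinj (by simp [hs _ hn])
    exact hn (by simpa [this] using hx)
  -- A preimage of `y` is a fixed point of the contraction `x ↦ y - G x`.
  · have hc : ContractingWith K fun x => y - G x := ⟨hK, by
      refine LipschitzWith.of_dist_le_mul fun a b => ?_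
      rw [dist_sub_left]
      exact hG.dist_le_mul a b⟩
    obtain ⟨x, hx, -⟩ := hc.exists_fixedPoint y (edist_ne_top _ _)
    have hx' : y - G x = x := hx
    have hxy : x + G x = y := (sub_eq_iff_eq_add.1 hx').symm
    refine ⟨x, ?_, hxy⟩
    by_contra hn
    rw [hs x hn, add_zero] at hxy
    exact hn (hxy ▸ hy)

/-- The closed unit ball does not retract to the sphere by a continuously differentiable map. -/
theorem not_exists_retraction {f : E → E} {U : Set E} (hU : IsOpen U)
    (hBU : closedBall (0 : E) 1 ⊆ U) (hf : ContDiffOn ℝ 1 f U)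
    (hnorm : ∀ x ∈ closedBall (0 : E) 1, ‖f x‖ = 1) (hfix : ∀ x ∈ sphere (0 : E) 1, f x = x) :
    False := by
  classical
  let _ : MeasurableSpace E := borel E
  have : BorelSpace E := ⟨rfl⟩
  let μ : Measure E := volume
  let B : Set E := ball 0 1
  have hcB : IsCompact (closedBall (0 : E) 1) := isCompact_closedBall 0 1
  have hBB : B ⊆ closedBall 0 1 := ball_subset_closedBall
  have hdf : ∀ x ∈ closedBall (0 : E) 1, HasFDerivAt f (fderiv ℝ f x) x := fun x hx =>
    ((hf.contDiffAt (hU.mem_nhds (hBU hx))).differentiableAt (by norm_num)).hasFDerivAt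
  have hcont : ContinuousOn (fderiv ℝ f) (closedBall 0 1) :=
    (hf.continuousOn_fderiv_of_isOpen hU le_rfl).mono hBU
  let A : E → E →L[ℝ] E := fun x => fderiv ℝ f x - 1
  have hA : ContinuousOn A (closedBall 0 1) := hcont.sub continuousOn_const
  have hdg : ∀ x ∈ closedBall (0 : E) 1, HasFDerivAt (fun x => f x - x) (A x) x := fun x hx =>
    (hdf x hx).sub (hasFDerivAt_id x)
  obtain ⟨C, hC⟩ : ∃ C : ℝ≥0, LipschitzOnWith C (fun x => f x - x) (closedBall 0 1) := by
    obtain ⟨C, hC⟩ := hcB.exists_bound_of_continuousOn hA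
    refine ⟨C.toNNReal, (convex_closedBall 0 1).lipschitzOnWith_of_nnnorm_hasFDerivWithin_le
      (fun x hx => (hdg x hx).hasFDerivWithinAt) fun x hx => ?_⟩
    exact NNReal.coe_le_coe.1 (by simpa using (hC x hx).trans (Real.le_coe_toNNReal C))
  let G := (closedBall (0 : E) 1).indicator fun x => f x - x
  have hG : LipschitzWith C G := lipschitzWith_indicator_closedBall hC fun x hx => by
    simp [hfix x hx]
  have hG0 : ∀ x ∉ B, G x = 0 := by
    intro x hx
    by_cases hx' : x ∈ closedBall (0 : E) 1
    · have : x ∈ sphere (0 : E) 1 := by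
        simp only [B, mem_ball, mem_closedBall, mem_sphere, not_lt] at hx hx' ⊢
        exact le_antisymm hx' hx
      simp [G, hfix x this]
    · simp [G, indicator_of_notMem hx']
  have hdetc : Continuous fun p : ℝ × (E →L[ℝ] E) => (1 + p.1 • p.2).det :=
    ContinuousLinearMap.continuous_det.comp (by fun_prop)
  have hdet : ∀ t : ℝ, ContinuousOn (fun x => (1 + t • A x).det) (closedBall 0 1) := fun t =>
    (hdetc.comp (Continuous.prodMk_right t)).comp_continuousOn hA
  have hpos : ∀ᶠ t in 𝓝 (0 : ℝ), ∀ x ∈ closedBall (0 : E) 1, 0 < (1 + t • A x).det := by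
    have hK : IsCompact (A '' closedBall (0 : E) 1) := hcB.image_of_continuousOn hA
    have := hK.eventually_forall_of_forall_eventually (x₀ := (0 : ℝ))
      (P := fun t M => 0 < (1 + t • M).det) fun M _ => by
        refine hdetc.continuousAt.eventually (lt_mem_nhds ?_)
        simp [ContinuousLinearMap.det]
    filter_upwards [this] with t ht x hx using ht _ (mem_image_of_mem A hx)
  obtain ⟨ε, hε, hεpos⟩ := Metric.eventually_nhds_iff.1 hpos
  -- Below `ε` the Jacobian determinants are positive; below `1 / (C + 1)` the perturbation `t • G`
  -- is a contraction.
  let δ := min ε (1 / (C + 1))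
  have hδ : 0 < δ := lt_min hε (by positivity)
  -- For small `t` the map `x + t • G x` permutes the ball, so its Jacobian determinant integrates
  -- to the volume.
  have hvol : ∀ t, 0 < t → t < δ → ∫ x in B, (1 + t • A x).det ∂μ = μ.real B := by
    intro t ht htδ
    have htC : t * C < 1 := by
      have : t < 1 / (C + 1) := htδ.trans_le (min_le_right _ _)
      rw [lt_div_iff₀ (by positivity)] at this
      nlinarith
    have hbij : BijOn (fun x => x + t • G x) B B := by
      refine bijOn_add_of_lipschitz (K := t.toNNReal * C) ?_ (G := fun x => t • G x) ?_ ?_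
      · rw [← NNReal.coe_lt_coe]; simpa [ht.le] using htC
      · refine LipschitzWith.of_dist_le_mul fun a b => ?_
        rw [dist_smul₀]
        have := hG.dist_le_mul a b
        simp only [NNReal.coe_mul, Real.coe_toNNReal _ ht.le, Real.norm_of_nonneg ht.le, mul_assoc]
        gcongr
      · intro x hx; simp [hG0 x hx]
    have hder : ∀ x ∈ B, HasFDerivWithinAt (fun x => x + t • G x) (1 + t • A x) B x := by
      intro x hx
      have h1 : HasFDerivAt (fun x => x + t • (f x - x)) (1 + t • A x) x :=
        (hasFDerivAt_id x).add ((hdg x (hBB hx)).const_smul t)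
      refine h1.hasFDerivWithinAt.congr (fun y hy => ?_) ?_
      · simp [G, indicator_of_mem (hBB hy)]
      · simp [G, indicator_of_mem (hBB hx)]
    have := integral_image_eq_integral_abs_det_fderiv_smul μ measurableSet_ball hder hbij.injOn
      (fun _ => (1 : ℝ))
    rw [hbij.image_eq] at this
    simp only [smul_eq_mul, mul_one, integral_const, MeasurableSet.univ, measureReal_restrict_apply,
      univ_inter] at this
    rw [this]
    refine setIntegral_congr_fun measurableSet_ball fun x hx => ?_
    refine (abs_of_pos (hεpos ?_ x (hBB hx))).symm
    rw [dist_zero_right, Real.norm_of_nonneg ht.le]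
    exact htδ.trans_le (min_le_left _ _)
  obtain ⟨s, w, hs, hw⟩ := exists_extrapolation (Module.finrank ℝ E) hδ
  have hint : ∀ t : ℝ, IntegrableOn (fun x => (1 + t • A x).det) B μ := fun t =>
    ((hdet t).integrableOn_compact hcB).mono_set hBB
  -- The integral is a polynomial in `t` that is constant near `0`, so it has the same value at `t =
  -- 1`. The extrapolation is done pointwise, with common nodes and weights.
  have hsum : ∫ x in B, (1 + (1 : ℝ) • A x).det ∂μ = μ.real B := by
    have h1 : ∀ x, (1 + (1 : ℝ) • A x).det = ∑ t ∈ s, w t * (1 + t • A x).det := by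
      intro x
      obtain ⟨p, hp, hpe⟩ := exists_polynomial_det_one_add_smul (A x)
      simp only [hpe]
      exact hw p hp
    simp only [h1]
    rw [integral_finsetSum _ fun t _ => (hint t).const_mul _]
    have h2 := hw 1 (by simp)
    simp only [Polynomial.eval_one, mul_one] at h2
    calc _ = ∑ t ∈ s, w t * μ.real B := Finset.sum_congr rfl fun t ht => by
          rw [integral_const_mul, hvol t (hs t ht).1 (hs t ht).2]
      _ = _ := by rw [← Finset.sum_mul, ← h2, one_mul]
  -- At `t = 1` the Jacobian is that of `f`. It is singular: if `Df v = f x`, differentiating `‖f‖²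
  -- = 1` along `v` would give `2 ‖f x‖² = 0`.
  have hzero : ∀ x ∈ B, (1 + (1 : ℝ) • A x).det = 0 := by
    intro x hx
    have hAx : 1 + (1 : ℝ) • A x = fderiv ℝ f x := by simp [A]
    rw [hAx]
    by_contra hne
    have hu : IsUnit (fderiv ℝ f x).toLinearMap := by
      rw [LinearMap.isUnit_iff_isUnit_det]
      exact isUnit_iff_ne_zero.2 hne
    obtain ⟨v, hv⟩ := ((Module.End.isUnit_iff _).1 hu).surjective (f x)
    have h1 : HasFDerivAt (fun y => inner ℝ (f y) (f y)) _ x :=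
      (hdf x (hBB hx)).inner ℝ (hdf x (hBB hx))
    have h2 : HasFDerivAt (fun y => inner ℝ (f y) (f y)) (0 : E →L[ℝ] ℝ) x := by
      refine (hasFDerivAt_const (1 : ℝ) x).congr_of_eventuallyEq ?_
      filter_upwards [isOpen_ball.mem_nhds hx] with y hy
      rw [real_inner_self_eq_norm_sq, hnorm y (hBB hy), one_pow]
    have h3 := congrArg (fun l : E →L[ℝ] ℝ => l v) (h1.unique h2)
    have hv' : fderiv ℝ f x v = f x := hv
    simp [fderivInnerCLM_apply, hv', hnorm x (hBB hx)] at h3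
  rw [setIntegral_congr_fun measurableSet_ball hzero] at hsum
  have hpos' : 0 < μ.real B := by
    rw [measureReal_def, ENNReal.toReal_pos_iff]
    exact ⟨measure_ball_pos μ _ one_pos, measure_ball_lt_top⟩
  simp at hsum
  linarith

end Brouwer

/-! ### Brouwer's theorem and variational inequalities. -/

section FixedPoint

open Metric Set Topology
open scoped Manifold ContDiff RealInnerProductSpace

variable {E : Type*} [NormedAddCommGroup E] [InnerProductSpace ℝ E]

section

variable [FiniteDimensional ℝ E]

/-- Brouwer's theorem for a smooth map into the closed unit ball. -/
theorem exists_fixedPoint_of_contDiff {g : E → E} (hg : ContDiff ℝ 1 g) (h1 : ∀ x, ‖g x‖ ≤ 1) :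
    ∃ x, g x = x := by
  by_contra! hne
  let u : E → E := fun x => x - g x
  have hu0 : ∀ x, ‖u x‖ ^ 2 ≠ 0 := fun x => by
    simpa [u, sub_eq_zero] using (hne x).symm
  have hu : ContDiff ℝ 1 u := contDiff_id.sub hg
  let b : E → ℝ := fun x => ⟪x, u x⟫
  have hb : ContDiff ℝ 1 b := contDiff_id.inner ℝ hu
  -- The retraction follows the ray from `g x` through `x` to the sphere. It solves `‖x + s • u x‖ =
  -- 1`, a quadratic equation in `s` with quarter discriminant `D x`; `s` below is the larger root.
  let D : E → ℝ := fun x => b x ^ 2 + ‖u x‖ ^ 2 * (1 - ‖x‖ ^ 2)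
  have hD : ContDiff ℝ 1 D :=
    (hb.pow 2).add ((hu.norm_sq ℝ).mul (contDiff_const.sub (contDiff_id.norm_sq ℝ)))
  have hbpos : ∀ x, ‖x‖ = 1 → 0 < b x := by
    intro x hx
    have h2 : ⟪x, g x⟫ ≠ 1 := fun h => by
      have h3 : ‖g x - x‖ ^ 2 ≤ 0 := by
        rw [norm_sub_sq_real, real_inner_comm, h, hx]
        nlinarith [h1 x, norm_nonneg (g x)]
      exact hne x (sub_eq_zero.1 (norm_eq_zero.1 (by nlinarith [norm_nonneg (g x - x)])))
    have h3 : ⟪x, g x⟫ ≤ 1 := (real_inner_le_norm x (g x)).trans (by rw [hx, one_mul]; exact h1 x)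
    have h4 : b x = 1 - ⟪x, g x⟫ := by
      simp only [b, u, inner_sub_right, real_inner_self_eq_norm_sq, hx, one_pow]
    rw [h4]
    exact sub_pos.2 (lt_of_le_of_ne h3 h2)
  have hDpos : ∀ x ∈ closedBall (0 : E) 1, 0 < D x := by
    intro x hx
    rw [mem_closedBall, dist_zero_right] at hx
    have hupos : 0 < ‖u x‖ ^ 2 := lt_of_le_of_ne (sq_nonneg _) (hu0 x).symm
    rcases hx.lt_or_eq with h | h
    · have : 0 < 1 - ‖x‖ ^ 2 := by nlinarith [norm_nonneg x]
      have := mul_pos hupos this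
      have := sq_nonneg (b x)
      simp only [D]; linarith
    · have := hbpos x h
      simp only [D, h]; nlinarith
  let s : E → ℝ := fun x => (√(D x) - b x) / ‖u x‖ ^ 2
  refine not_exists_retraction (f := fun x => x + s x • u x) (U := {x | 0 < D x})
    (isOpen_lt continuous_const hD.continuous) hDpos ?_ ?_ ?_
  · have hs : ContDiffOn ℝ 1 s {x | 0 < D x} :=
      ((hD.contDiffOn.sqrt fun x hx => ne_of_gt hx).sub hb.contDiffOn).div
        (hu.norm_sq ℝ).contDiffOn fun x _ => hu0 x
    exact contDiffOn_id.add (hs.smul hu.contDiffOn)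
  · intro x hx
    have h2 : s x * ‖u x‖ ^ 2 = √(D x) - b x := div_mul_cancel₀ _ (hu0 x)
    have h3 : √(D x) ^ 2 = D x := Real.sq_sqrt (hDpos x hx).le
    have h4 : ‖x + s x • u x‖ ^ 2 = ‖x‖ ^ 2 + 2 * (s x * b x) + s x ^ 2 * ‖u x‖ ^ 2 := by
      rw [norm_add_sq_real, inner_smul_right, norm_smul, mul_pow, Real.norm_eq_abs, sq_abs]
    have h5 : ‖x + s x • u x‖ ^ 2 = 1 := by
      refine mul_left_cancel₀ (hu0 x) ?_
      rw [h4]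
      have h6 : ‖u x‖ ^ 2 * (‖x‖ ^ 2 + 2 * (s x * b x) + s x ^ 2 * ‖u x‖ ^ 2) =
          ‖u x‖ ^ 2 * ‖x‖ ^ 2 + 2 * (s x * ‖u x‖ ^ 2) * b x + (s x * ‖u x‖ ^ 2) ^ 2 := by ring
      rw [h6, h2]
      have h7 : D x = b x ^ 2 + ‖u x‖ ^ 2 * (1 - ‖x‖ ^ 2) := rfl
      linear_combination h3 + h7
    exact (pow_eq_one_iff_of_nonneg (norm_nonneg _) two_ne_zero).1 h5
  · intro x hx
    rw [mem_sphere, dist_zero_right] at hx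
    -- On the sphere `D = b ^ 2` with `b > 0`, so the larger root is `0`.
    have : √(D x) = b x := by
      simp only [D, hx]
      rw [one_pow, sub_self, mul_zero, add_zero, Real.sqrt_sq (hbpos x hx).le]
    simp [s, this]

/-- **Brouwer's fixed point theorem** for a continuous map into the closed unit ball. -/
theorem exists_fixedPoint_of_norm_le_one {f : E → E} (hf : Continuous f) (h1 : ∀ x, ‖f x‖ ≤ 1) :
    ∃ x, f x = x := by
  by_contra! hne
  have hpos : ∃ δ > 0, ∀ x ∈ closedBall (0 : E) 1, δ ≤ dist (f x) x := by
    obtain ⟨x, -, hx⟩ := (isCompact_closedBall (0 : E) 1).exists_isMinOn ⟨0, by simp⟩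
      (hf.dist continuous_id).continuousOn
    exact ⟨_, dist_pos.2 (hne x), fun y hy => hx hy⟩
  obtain ⟨δ, hδ, hmin⟩ := hpos
  -- A partition of unity gives a smooth `g` within `δ` of `f` and with values in the ball; a fixed
  -- point of `g` would be moved by `f` by less than the minimum `δ`.
  obtain ⟨g, hg⟩ := exists_contMDiffMap_forall_mem_convex_of_local_const (n := 1) (𝓘(ℝ, E))
    (t := fun x : E => ball (f x) δ ∩ closedBall 0 1)
    (fun x => (convex_ball _ _).inter (convex_closedBall _ _)) fun x => ⟨f x, by
      filter_upwards [hf.continuousAt.eventually (ball_mem_nhds (f x) hδ)] with y hy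
      refine ⟨by simpa [dist_comm] using hy, by simpa using h1 x⟩⟩
  obtain ⟨x, hx⟩ := exists_fixedPoint_of_contDiff (g := g) g.contMDiff.contDiff
    fun x => by simpa using (hg x).2
  have h2 := hg x
  rw [hx] at h2
  have h3 : dist x (f x) < δ := h2.1
  rw [dist_comm] at h3
  exact absurd (hmin x h2.2) (not_le.2 h3)

/-- **Brouwer's fixed point theorem** for a bounded continuous self-map. -/
theorem exists_fixedPoint_of_norm_le {f : E → E} (hf : Continuous f) {R : ℝ}
    (hR : ∀ x, ‖f x‖ ≤ R) : ∃ x, f x = x := by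
  have hR0 : 0 < max R 1 := lt_max_of_lt_right one_pos
  obtain ⟨x, hx⟩ := exists_fixedPoint_of_norm_le_one
    (f := fun x => (max R 1)⁻¹ • f (max R 1 • x)) (by fun_prop) fun x => by
      rw [norm_smul, norm_inv, Real.norm_of_nonneg hR0.le, inv_mul_le_iff₀ hR0, mul_one]
      exact (hR _).trans (le_max_left _ _)
  exact ⟨max R 1 • x, by rw [← inv_smul_eq_iff₀ hR0.ne']; exact hx⟩

end

/-- The metric projection onto a complete convex set. -/
theorem exists_continuous_projection [CompleteSpace E] {K : Set E} (hne : K.Nonempty)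
    (hK : IsClosed K) (hc : Convex ℝ K) :
    ∃ P : E → E, Continuous P ∧ (∀ x, P x ∈ K) ∧ ∀ x, ∀ y ∈ K, ⟪x - P x, y - P x⟫ ≤ 0 := by
  have h : ∀ x : E, ∃ v ∈ K, ∀ y ∈ K, ⟪x - v, y - v⟫ ≤ 0 := fun x => by
    obtain ⟨v, hv, h⟩ := exists_norm_eq_iInf_of_complete_convex hne hK.isComplete hc x
    exact ⟨v, hv, (norm_eq_iInf_iff_real_inner_le_zero hc hv).1 h⟩
  choose P hPK hP using h
  refine ⟨P, LipschitzWith.continuous (K := 1) (LipschitzWith.of_dist_le_mul fun x y => ?_),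
    hPK, hP⟩
  rw [NNReal.coe_one, one_mul, dist_eq_norm, dist_eq_norm]
  have h1 := hP x (P y) (hPK y)
  have h2 := hP y (P x) (hPK x)
  -- The sum of the two obtuse angle conditions; with Cauchy–Schwarz it shows that `P` is
  -- nonexpansive.
  have h3 : ‖P x - P y‖ ^ 2 ≤ ⟪x - y, P x - P y⟫ := by
    have h4 : ⟪x - y, P x - P y⟫ - ‖P x - P y‖ ^ 2 =
        -⟪x - P x, P y - P x⟫ - ⟪y - P y, P x - P y⟫ := by
      rw [← real_inner_self_eq_norm_sq]
      simp only [inner_sub_left, inner_sub_right]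
      ring
    linarith
  have h4 := h3.trans (real_inner_le_norm _ _)
  by_contra! hlt
  nlinarith [norm_nonneg (x - y)]

/-- A continuous vector field on a compact convex set solves a variational inequality. -/
theorem exists_variational_inequality [FiniteDimensional ℝ E] {K : Set E} (hne : K.Nonempty)
    (hK : IsCompact K) (hc : Convex ℝ K) {F : E → E} (hF : Continuous F) :
    ∃ x ∈ K, ∀ y ∈ K, ⟪F x, y - x⟫ ≤ 0 := by
  obtain ⟨P, hPc, hPK, hP⟩ := exists_continuous_projection hne hK.isClosed hc
  obtain ⟨R, hR⟩ := hK.isBounded.exists_norm_le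
  -- If `x = P (x + F x)`, the obtuse angle condition at `x + F x` is the variational inequality.
  obtain ⟨x, hx⟩ := exists_fixedPoint_of_norm_le (f := fun x => P (x + F x)) (by fun_prop)
    fun x => hR _ (hPK _)
  refine ⟨x, hx ▸ hPK _, fun y hy => ?_⟩
  have := hP (x + F x) y hy
  rw [hx] at this
  simpa using this

end FixedPoint

/-! ### Equilibria of bilinear games of finite rank. -/

section Bilinear

variable {E F : Type*} [AddCommGroup E] [Module ℝ E] [TopologicalSpace E]
  [AddCommGroup F] [Module ℝ F] [TopologicalSpace F]

/-- A payoff that is a finite sum of products of continuous linear functionals. -/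
def IsFiniteRank (u : E → F → ℝ) : Prop :=
  ∃ (n : ℕ) (f : Fin n → E →L[ℝ] ℝ) (g : Fin n → F →L[ℝ] ℝ), ∀ x y, u x y = ∑ i, f i x * g i y

theorem isFiniteRank_sum {ι : Type*} (s : Finset ι) (f : ι → E →L[ℝ] ℝ) (g : ι → F →L[ℝ] ℝ) :
    IsFiniteRank fun x y => ∑ i ∈ s, f i x * g i y := by
  refine ⟨s.card, fun i => f (s.equivFin.symm i), fun i => g (s.equivFin.symm i), fun x y => ?_⟩
  refine (Finset.sum_coe_sort s fun i => f i x * g i y).symm.trans ?_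
  exact (Equiv.sum_comp s.equivFin.symm fun i : s => f i x * g i y).symm

/-- A two-player game with bilinear payoffs of finite rank on compact convex strategy sets has a
Nash equilibrium. -/
theorem exists_bilinear_equilibrium {X : Set E} {Y : Set F} (hX : X.Nonempty) (hY : Y.Nonempty)
    (hXc : IsCompact X) (hYc : IsCompact Y) (hXv : Convex ℝ X) (hYv : Convex ℝ Y)
    {u v : E → F → ℝ} (hu : IsFiniteRank u) (hv : IsFiniteRank v) :
    ∃ x ∈ X, ∃ y ∈ Y, (∀ x' ∈ X, u x' y ≤ u x y) ∧ ∀ y' ∈ Y, v x y' ≤ v x y := by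
  obtain ⟨n, f, g, hu⟩ := hu
  obtain ⟨m, f', g', hv⟩ := hv
  let Φ : E × F →L[ℝ] EuclideanSpace ℝ ((Fin n ⊕ Fin n) ⊕ (Fin m ⊕ Fin m)) := (EuclideanSpace.equiv _ ℝ).symm.toContinuousLinearMap ∘L
    ContinuousLinearMap.pi (Sum.elim
      (Sum.elim (fun i => f i ∘L .fst ℝ E F) fun i => g i ∘L .snd ℝ E F)
      (Sum.elim (fun j => f' j ∘L .fst ℝ E F) fun j => g' j ∘L .snd ℝ E F))
  -- `A` holds the gradient of `u` in the first player's coordinates and that of `v` in the second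
  -- player's, so that `⟪A z, z' - z⟫` is the sum of both players' gains from unilateral deviations.
  -- Setting `y' = y` or `x' = x` separates them.
  let A : EuclideanSpace ℝ ((Fin n ⊕ Fin n) ⊕ (Fin m ⊕ Fin m)) →
      EuclideanSpace ℝ ((Fin n ⊕ Fin n) ⊕ (Fin m ⊕ Fin m)) := fun z => WithLp.toLp 2 (Sum.elim
      (Sum.elim (fun i => z (.inl (.inr i))) fun _ => 0)
      (Sum.elim (fun _ => 0) fun j => z (.inr (.inl j))))
  have hA : Continuous A := by
    refine (PiLp.continuous_toLp 2 _).comp (continuous_pi ?_)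
    rintro ((i | i) | (i | i)) <;> simp only [Sum.elim_inl, Sum.elim_inr] <;> fun_prop
  obtain ⟨_, ⟨⟨x, y⟩, ⟨hx, hy⟩, rfl⟩, h⟩ := exists_variational_inequality
    ((hX.prod hY).image Φ) ((hXc.prod hYc).image Φ.continuous)
    ((hXv.prod hYv).is_linear_image Φ.isLinear) hA
  have key : ∀ x' ∈ X, ∀ y' ∈ Y, (∑ i, (f i x' - f i x) * g i y) +
      ∑ j, f' j x * (g' j y' - g' j y) ≤ 0 := by
    intro x' hx' y' hy'
    have := h _ ⟨(x', y'), ⟨hx', hy'⟩, rfl⟩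
    simpa [PiLp.inner_apply, A, Φ, Fintype.sum_sum_type, mul_comm] using this
  refine ⟨x, hx, y, hy, fun x' hx' => ?_, fun y' hy' => ?_⟩
  · have := key x' hx' y hy
    simpa [hu, sub_mul, Finset.sum_sub_distrib] using this
  · have := key x hx y' hy'
    simpa [hv, mul_sub, Finset.sum_sub_distrib] using this

end Bilinear

/-! ### Realization plans and behavioral strategies. -/

section SequenceForm

variable {L α S : Type*} [Fintype α]

/-- Probability that a player's own choices along a record are made, under a behavioral strategy. -/
noncomputable def reach (p : L → List (Option α × S) → PMF α) (l : L) :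
    List (Option α × S) → ℝ
  | [] => 1
  | (none, _) :: y => reach p l y
  | (some a, _) :: y => reach p l y * (p l y a).toReal

/-- Realization plans: the linear constraints that describe reach probabilities. -/
structure IsPlan (adm : L → List (Option α × S) → Set α) (x : L → List (Option α × S) → ℝ) :
    Prop where
  nonneg : ∀ l y, 0 ≤ x l y
  nil : ∀ l, x l [] = 1
  pass : ∀ l s y, x l ((none, s) :: y) = x l y
  indep : ∀ l a s s' y, x l ((some a, s) :: y) = x l ((some a, s') :: y)
  total : ∀ l s y, ∑ a, x l ((some a, s) :: y) = x l y
  admissible : ∀ l a s y, a ∉ adm l y → x l ((some a, s) :: y) = 0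

variable {adm : L → List (Option α × S) → Set α}

omit [Fintype α] in
theorem reach_nonneg (p : L → List (Option α × S) → PMF α) (l : L) :
    ∀ y, 0 ≤ reach p l y
  | [] => zero_le_one
  | (none, _) :: y => reach_nonneg p l y
  | (some _, _) :: y => mul_nonneg (reach_nonneg p l y) ENNReal.toReal_nonneg

theorem sum_toReal_eq_one (p : PMF α) : ∑ a, (p a).toReal = 1 := by
  rw [← ENNReal.toReal_sum fun a _ => p.apply_ne_top a, ← tsum_fintype (L := .unconditional α),
    p.tsum_coe, ENNReal.toReal_one]

theorem isPlan_reach {p : L → List (Option α × S) → PMF α}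
    (hp : ∀ l y, (p l y).support ⊆ adm l y) : IsPlan adm (reach p) where
  nonneg := reach_nonneg p
  nil _ := rfl
  pass _ _ _ := rfl
  indep _ _ _ _ _ := rfl
  total l s y := by
    simp only [reach]
    rw [← Finset.mul_sum, sum_toReal_eq_one, mul_one]
  admissible l a s y ha := by
    have : p l y a = 0 := by
      by_contra h
      exact ha (hp l y ((PMF.mem_support_iff _ _).2 h))
    simp [reach, this]

theorem IsPlan.le_one {x : L → List (Option α × S) → ℝ} (hx : IsPlan adm x) (l : L) :
    ∀ y, x l y ≤ 1
  | [] => (hx.nil l).le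
  | (none, s) :: y => (hx.pass l s y).le.trans (hx.le_one l y)
  | (some a, s) :: y => by
    refine le_trans ?_ (hx.le_one l y)
    rw [← hx.total l s y]
    exact Finset.single_le_sum (f := fun a => x l ((some a, s) :: y)) (fun b _ => hx.nonneg l _)
      (Finset.mem_univ a)

/-- Every realization plan comes from a behavioral strategy. -/
theorem IsPlan.exists_reach_eq [Nonempty S] (hadm : ∀ l y, (adm l y).Nonempty)
    {x : L → List (Option α × S) → ℝ} (hx : IsPlan adm x) :
    ∃ p : L → List (Option α × S) → PMF α, (∀ l y, (p l y).support ⊆ adm l y) ∧ reach p = x := by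
  obtain ⟨s₀⟩ := ‹Nonempty S›
  have h : ∀ l y, ∃ q : PMF α, q.support ⊆ adm l y ∧
      ∀ a s, x l y * (q a).toReal = x l ((some a, s) :: y) := by
    intro l y
    -- At a record of weight `0` all continuations also have weight `0`, and any admissible action
    -- will do. Otherwise the conditional weights are used; by `indep` the choice of `s₀` is
    -- immaterial.
    rcases (hx.nonneg l y).eq_or_lt with h0 | h0
    · obtain ⟨a, ha⟩ := hadm l y
      refine ⟨PMF.pure a, by simpa using ha, fun b s => ?_⟩
      rw [← h0, zero_mul]
      have := hx.total l s y
      rw [← h0, Finset.sum_eq_zero_iff_of_nonneg fun c _ => hx.nonneg l _] at this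
      exact (this b (Finset.mem_univ b)).symm
    · have hnn : ∀ a, 0 ≤ x l ((some a, s₀) :: y) / x l y := fun a =>
        div_nonneg (hx.nonneg l _) h0.le
      refine ⟨PMF.ofFintype (fun a => ENNReal.ofReal (x l ((some a, s₀) :: y) / x l y)) ?_, ?_, ?_⟩
      · rw [← ENNReal.ofReal_sum_of_nonneg fun a _ => hnn a, ← Finset.sum_div, hx.total,
          div_self h0.ne', ENNReal.ofReal_one]
      · intro a ha
        by_contra hn
        simp [hx.admissible l a s₀ y hn] at ha
      · intro a s
        rw [PMF.ofFintype_apply, ENNReal.toReal_ofReal (hnn a), mul_div_cancel₀ _ h0.ne']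
        exact hx.indep l a s₀ s y
  choose p hp hpx using h
  refine ⟨p, hp, ?_⟩
  funext l y
  induction y with
  | nil => exact (hx.nil l).symm
  | cons e y ih =>
    obtain ⟨_ | a, s⟩ := e
    · rw [reach, ih, hx.pass]
    · rw [reach, ih, hpx l y a s]

/-- Records have unbounded length, so plans live in an infinite product. Its pointwise topology
suffices: the constraints involve finitely many coordinates each and are closed, and Tychonoff
applies to the unit cube. -/
theorem isCompact_setOf_isPlan (adm : L → List (Option α × S) → Set α) :
    IsCompact {x | IsPlan adm x} := by
  have hbox : IsCompact (Set.univ.pi fun _ : L => Set.univ.pi fun _ : List (Option α × S) =>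
      Set.Icc (0 : ℝ) 1) := isCompact_univ_pi fun _ => isCompact_univ_pi fun _ => isCompact_Icc
  refine hbox.of_isClosed_subset ?_ fun x hx l _ y _ => ⟨hx.nonneg l y, hx.le_one l y⟩
  have hc : ∀ l (y : List (Option α × S)),
      Continuous fun x : L → List (Option α × S) → ℝ => x l y := fun l y => by fun_prop
  have heq : {x | IsPlan adm x} = {x | (∀ l y, 0 ≤ x l y) ∧ (∀ l, x l [] = 1) ∧
      (∀ l s y, x l ((none, s) :: y) = x l y) ∧
      (∀ l a s s' y, x l ((some a, s) :: y) = x l ((some a, s') :: y)) ∧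
      (∀ l s y, ∑ a, x l ((some a, s) :: y) = x l y) ∧
      ∀ l a s y, a ∉ adm l y → x l ((some a, s) :: y) = 0} := by
    ext x
    exact ⟨fun h => ⟨h.nonneg, h.nil, h.pass, h.indep, h.total, h.admissible⟩,
      fun ⟨h1, h2, h3, h4, h5, h6⟩ => ⟨h1, h2, h3, h4, h5, h6⟩⟩
  rw [heq]
  simp only [Set.ofPred_and, Set.ofPred_forall]
  refine IsClosed.inter ?_ <| IsClosed.inter ?_ <| IsClosed.inter ?_ <| IsClosed.inter ?_ <|
    IsClosed.inter ?_ ?_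
  · exact isClosed_iInter fun l => isClosed_iInter fun y => isClosed_le continuous_const (hc l y)
  · exact isClosed_iInter fun l => isClosed_eq (hc l _) continuous_const
  · exact isClosed_iInter fun l => isClosed_iInter fun s => isClosed_iInter fun y =>
      isClosed_eq (hc l _) (hc l y)
  · exact isClosed_iInter fun l => isClosed_iInter fun a => isClosed_iInter fun s =>
      isClosed_iInter fun s' => isClosed_iInter fun y => isClosed_eq (hc l _) (hc l _)
  · exact isClosed_iInter fun l => isClosed_iInter fun s => isClosed_iInter fun y =>
      isClosed_eq (continuous_finsetSum _ fun a _ => hc l _) (hc l y)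
  · exact isClosed_iInter fun l => isClosed_iInter fun a => isClosed_iInter fun s =>
      isClosed_iInter fun y => isClosed_iInter fun _ => isClosed_eq (hc l _) continuous_const

theorem convex_setOf_isPlan (adm : L → List (Option α × S) → Set α) :
    Convex ℝ {x | IsPlan adm x} := by
  intro x hx y hy a b ha hb hab
  refine ⟨fun l r => ?_, fun l => ?_, fun l s r => ?_, fun l c s s' r => ?_, fun l s r => ?_,
    fun l c s r hc => ?_⟩ <;> simp only [Pi.add_apply, Pi.smul_apply, smul_eq_mul]
  · exact add_nonneg (mul_nonneg ha (hx.nonneg l r)) (mul_nonneg hb (hy.nonneg l r))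
  · rw [hx.nil, hy.nil, mul_one, mul_one, hab]
  · rw [hx.pass, hy.pass]
  · rw [hx.indep l c s s', hy.indep l c s s']
  · rw [Finset.sum_add_distrib, ← Finset.mul_sum, ← Finset.mul_sum, hx.total, hy.total]
  · rw [hx.admissible l c s r hc, hy.admissible l c s r hc, mul_zero, mul_zero, add_zero]

end SequenceForm

/-! ### Expectations under finitely supported laws. -/

section Expectation

variable {α β : Type*}

theorem expect_eq_sum {p : PMF α} {s : Finset α} (hs : p.support ⊆ s) (f : α → ℝ) :
    expect p f = ∑ a ∈ s, (p a).toReal * f a := by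
  refine tsum_eq_sum fun a ha => ?_
  have : p a = 0 := by
    by_contra h
    exact ha (hs ((PMF.mem_support_iff _ _).2 h))
  simp [this]

theorem expect_fintype [Fintype α] (p : PMF α) (f : α → ℝ) :
    expect p f = ∑ a, (p a).toReal * f a :=
  expect_eq_sum (by simp) f

theorem expect_pure (a : α) (f : α → ℝ) : expect (PMF.pure a) f = f a := by
  rw [expect_eq_sum (s := {a}) (by simp)]
  simp

theorem expect_eq_zero {p : PMF α} {f : α → ℝ} (h : ∀ a ∈ p.support, f a = 0) :
    expect p f = 0 := by
  unfold expect
  rw [← tsum_zero]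
  congr 1
  funext a
  by_cases ha : a ∈ p.support
  · rw [h a ha, mul_zero]
  · rw [PMF.mem_support_iff, not_not] at ha
    rw [ha, ENNReal.toReal_zero, zero_mul]

theorem support_bind_finite {p : PMF α} {k : α → PMF β} (hp : p.support.Finite)
    (hk : ∀ a, (k a).support.Finite) : (p.bind k).support.Finite := by
  rw [PMF.support_bind]
  exact hp.biUnion fun a _ => hk a

theorem expect_bind {p : PMF α} {k : α → PMF β} (hp : p.support.Finite)
    (hk : ∀ a, (k a).support.Finite) (f : β → ℝ) :
    expect (p.bind k) f = expect p fun a => expect (k a) f := by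
  let t := (support_bind_finite hp hk).toFinset
  have ht : ∀ a ∈ hp.toFinset, (k a).support ⊆ t := by
    intro a ha b hb
    simp only [t, Set.Finite.coe_toFinset, PMF.support_bind, Set.mem_iUnion]
    exact ⟨a, by simpa using ha, hb⟩
  have hval : ∀ b, (p.bind k b).toReal = ∑ a ∈ hp.toFinset, (p a).toReal * (k a b).toReal := by
    intro b
    rw [PMF.bind_apply, tsum_eq_sum (s := hp.toFinset), ENNReal.toReal_sum]
    · simp only [ENNReal.toReal_mul]
    · exact fun a _ => ENNReal.mul_ne_top (p.apply_ne_top a) ((k a).apply_ne_top b)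
    · intro a ha
      simp only [Set.Finite.mem_toFinset, PMF.mem_support_iff, not_not] at ha
      rw [ha, zero_mul]
  rw [expect_eq_sum (s := t) (by simp [t]), expect_eq_sum (s := hp.toFinset) (by simp)]
  calc ∑ b ∈ t, (p.bind k b).toReal * f b
      = ∑ b ∈ t, ∑ a ∈ hp.toFinset, (p a).toReal * ((k a b).toReal * f b) := by
        refine Finset.sum_congr rfl fun b _ => ?_
        rw [hval, Finset.sum_mul]
        exact Finset.sum_congr rfl fun a _ => mul_assoc _ _ _
    _ = _ := by
        rw [Finset.sum_comm]
        refine Finset.sum_congr rfl fun a ha => ?_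
        rw [expect_eq_sum (ht a ha), Finset.mul_sum]

theorem expect_map {p : PMF α} (hp : p.support.Finite) (g : α → β) (f : β → ℝ) :
    expect (p.map g) f = expect p fun a => f (g a) := by
  rw [PMF.map, expect_bind hp fun a => by simp]
  simp only [Function.comp, expect_pure]

end Expectation

instance {V : Type*} [Finite V] : Finite (Loc V) :=
  Finite.of_surjective (fun o : Option (Option (Option V)) => match o with
    | none => Loc.source
    | some none => Loc.dropped
    | some (some none) => Loc.trapped
    | some (some (some v)) => Loc.node v) fun l => by
      cases l with
      | source => exact ⟨none, rfl⟩
      | node v => exact ⟨some (some (some v)), rfl⟩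
      | dropped => exact ⟨some none, rfl⟩
      | trapped => exact ⟨some (some none), rfl⟩

instance : Finite Player :=
  Finite.of_surjective (fun b : Bool => if b then Player.defender else Player.adversary) fun x => by
    cases x with
    | defender => exact ⟨true, rfl⟩
    | adversary => exact ⟨false, rfl⟩

instance {V : Type*} [Finite V] {W : ℕ} : Finite (State V W) :=
  Finite.of_injective (fun s : State V W => (s.turn, s.loc)) fun s t h => by
    cases s; cases t; simpa using h

/-! ### Bilinearity of expectations in the realization plans. -/

namespace Game

variable {V : Type*} [Fintype V] {W : ℕ} {G : Game V W}

theorem next_support_finite (pD : G.DefStrategy) (pA : G.AdvStrategy) (h : History V W) :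
    (next pD pA h).support.Finite := by
  unfold next
  split <;> refine support_bind_finite (Set.toFinite _) fun a => ?_ <;> rw [PMF.support_map] <;>
    exact (Set.toFinite _).image _

open scoped Classical in
theorem step_support_finite (T : ℕ∞) (pD : G.DefStrategy) (pA : G.AdvStrategy)
    (h : History V W) :
    (if G.Over T h then PMF.pure h else next pD pA h).support.Finite := by
  split
  · simp
  · exact next_support_finite pD pA h

theorem law_support_finite (T : ℕ∞) (pD : G.DefStrategy) (pA : G.AdvStrategy) (t : ℕ) :
    (law T pD pA t).support.Finite := by
  induction t with
  | zero => rw [law, PMF.support_map]; exact (Set.toFinite _).image _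
  | succ t ih => exact support_bind_finite ih (step_support_finite T pD pA)

/-- The realization plan of a defender strategy. -/
noncomputable def DefStrategy.plan (pD : G.DefStrategy) : Unit → DefInfo V W → ℝ :=
  reach fun _ => pD.prob

/-- The realization plan of an adversary strategy. -/
noncomputable def AdvStrategy.plan (pA : G.AdvStrategy) :
    Fin W → List (Option (Option V) × State V W) → ℝ :=
  reach fun m y => pA.prob ⟨m, y⟩

/-- A functional of the strategy pair and a test function on histories that is a finite combination
of values of the test function, weighted with the realization probabilities of both players. -/
def HasRep (Φ : G.DefStrategy → G.AdvStrategy → (History V W → ℝ) → ℝ) : Prop :=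
  ∃ c : History V W →₀ ℝ, ∀ pD pA f, Φ pD pA f =
    c.sum fun h w => w * f h * pD.plan () h.defInfo * pA.plan h.label h.advRecord

omit [Fintype V] in
theorem hasRep_single (h : History V W) (w : ℝ) : HasRep (G := G) fun pD pA f =>
    w * f h * pD.plan () h.defInfo * pA.plan h.label h.advRecord :=
  ⟨Finsupp.single h w, fun pD pA f => by rw [Finsupp.sum_single_index]; simp⟩

omit [Fintype V] in
theorem hasRep_sum {ι : Type*} (s : Finset ι)
    {Φ : ι → G.DefStrategy → G.AdvStrategy → (History V W → ℝ) → ℝ}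
    (hΦ : ∀ i, HasRep (Φ i)) : HasRep fun pD pA f => ∑ i ∈ s, Φ i pD pA f := by
  choose c hc using hΦ
  refine ⟨∑ i ∈ s, c i, fun pD pA f => ?_⟩
  rw [← Finsupp.sum_finsetSum_index]
  · exact Finset.sum_congr rfl fun i _ => hc i pD pA f
  · intro h; simp
  · intro h a b; ring

omit [Fintype V] in
theorem HasRep.congr {Φ Ψ : G.DefStrategy → G.AdvStrategy → (History V W → ℝ) → ℝ}
    (hΦ : HasRep Φ) (h : ∀ pD pA f, Ψ pD pA f = Φ pD pA f) : HasRep Ψ := by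
  obtain ⟨c, hc⟩ := hΦ
  exact ⟨c, fun pD pA f => (h pD pA f).trans (hc pD pA f)⟩

/-- One step of play keeps the representation by realization probabilities. -/
theorem hasRep_next (h : History V W) (w : ℝ) : HasRep (G := G) fun pD pA f =>
    w * expect (next pD pA h) f * pD.plan () h.defInfo * pA.plan h.label h.advRecord := by
  classical
  have : Fintype (State V W) := Fintype.ofFinite _
  cases ht : h.state.turn with
  | adversary =>
    -- The action probability extends the adversary's `reach` factor, the transition probability
    -- joins the coefficient, and the defender's factor is unchanged because the new entry of the
    -- defender's record is `none`.
    refine (hasRep_sum Finset.univ fun a : Option V => hasRep_sum Finset.univ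
      fun s : State V W => hasRep_single (History.advMove h a s)
        (w * (G.advTrans h.label h.state a s).toReal)).congr fun pD pA f => ?_
    have hn : next pD pA h = (pA.prob h.advInfo).bind fun a =>
      (G.advTrans h.label h.state a).map fun s => History.advMove h a s := by
        unfold next; rw [ht]
    rw [hn, expect_bind (Set.toFinite _) fun a => by
      rw [PMF.support_map]; exact (Set.toFinite _).image _]
    simp only [expect_map (Set.toFinite _), expect_fintype, Finset.mul_sum, Finset.sum_mul]
    refine Finset.sum_congr rfl fun a _ => Finset.sum_congr rfl fun s _ => ?_
    simp only [DefStrategy.plan, AdvStrategy.plan, History.defInfo, History.advRecord,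
      History.label, History.advInfo, reach]
    ring
  | defender =>
    refine (hasRep_sum Finset.univ fun d : Option (Fin W) => hasRep_sum Finset.univ
      fun s : State V W => hasRep_single (History.defMove h d s)
        (w * (G.defTrans h.label h.state d s).toReal)).congr fun pD pA f => ?_
    have hn : next pD pA h = (pD.prob h.defInfo).bind fun d =>
      (G.defTrans h.label h.state d).map fun s => History.defMove h d s := by
        unfold next; rw [ht]
    rw [hn, expect_bind (Set.toFinite _) fun a => by
      rw [PMF.support_map]; exact (Set.toFinite _).image _]
    simp only [expect_map (Set.toFinite _), expect_fintype, Finset.mul_sum, Finset.sum_mul]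
    refine Finset.sum_congr rfl fun a _ => Finset.sum_congr rfl fun s _ => ?_
    simp only [DefStrategy.plan, AdvStrategy.plan, History.defInfo, History.advRecord,
      History.label, reach]
    ring

/-- Expectations under the law of play are bilinear in the realization plans. -/
theorem hasRep_law (T : ℕ∞) (t : ℕ) :
    HasRep (G := G) fun pD pA f => expect (law T pD pA t) f := by
  classical
  induction t with
  | zero =>
    refine (hasRep_sum Finset.univ fun m : Fin W => hasRep_single (History.start m)
      (G.prior m).toReal).congr fun pD pA f => ?_
    rw [law, expect_map (Set.toFinite _), expect_fintype]
    simp [DefStrategy.plan, AdvStrategy.plan, History.defInfo, History.advRecord, reach]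
  | succ t ih =>
    obtain ⟨c, hc⟩ := ih
    refine (hasRep_sum c.support (Φ := fun h pD pA f => c h *
      expect (if G.Over T h then PMF.pure h else next pD pA h) f * pD.plan () h.defInfo *
        pA.plan h.label h.advRecord) fun h => ?_).congr fun pD pA f => ?_
    · by_cases ho : G.Over T h
      · simp only [ho, if_true, expect_pure]
        exact hasRep_single h (c h)
      · simp only [ho, if_false]
        exact hasRep_next h (c h)
    · rw [law, expect_bind (law_support_finite T pD pA t) (step_support_finite T pD pA)]
      -- The test function is here the one-step expectation of `f`, which depends on the strategies.
      -- This is allowed since the coefficients `c` are chosen before strategies and test function.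
      exact hc pD pA _

end Game

/-! ### Bounded length of plays. -/

namespace Game

variable {V : Type*} {W : ℕ} {G : Game V W}

/-- Induction principle for the histories that occur in a play. -/
theorem law_induction {T : ℕ∞} {pD : G.DefStrategy} {pA : G.AdvStrategy} {P : History V W → Prop}
    (start : ∀ m, P (History.start m))
    (step : ∀ h, P h → ¬ G.Over T h → ∀ h' ∈ (next pD pA h).support, P h') (t : ℕ) :
    ∀ h ∈ (law T pD pA t).support, P h := by
  classical
  induction t with
  | zero =>
    intro h hh
    rw [law, PMF.support_map] at hh
    obtain ⟨m, -, rfl⟩ := hh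
    exact start m
  | succ t ih =>
    intro h' hh'
    rw [law, PMF.mem_support_bind_iff] at hh'
    obtain ⟨h, hh, hk⟩ := hh'
    split_ifs at hk with ho
    · rw [PMF.mem_support_pure_iff] at hk
      exact hk ▸ ih h hh
    · exact step h (ih h hh) ho h' hk

/-- The successors of a history. -/
theorem exists_of_mem_support_next {pD : G.DefStrategy} {pA : G.AdvStrategy} {h h' : History V W}
    (hh : h' ∈ (next pD pA h).support) :
    (h.state.turn = Player.adversary ∧ ∃ a ∈ G.advActions h.advInfo,
      ∃ z ∈ (G.benign h.label h.state.loc a).support, ∃ l : Fin W → Loc V,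
        (∀ k, l k = if k = h.label then Loc.ofMove a else Loc.ofMove (z k)) ∧
        h' = History.advMove h a ⟨Player.defender, l⟩) ∨
    (h.state.turn = Player.defender ∧ ∃ d, ∃ l : Fin W → Loc V,
      (∀ k, l k = h.state.loc k ∨ l k = Loc.trapped) ∧
        h' = History.defMove h d ⟨Player.adversary, l⟩) := by
  classical
  unfold next at hh
  split at hh
  next ht =>
    left
    refine ⟨ht, ?_⟩
    simp only [PMF.mem_support_bind_iff, PMF.support_map, Set.mem_image, advTrans] at hh
    obtain ⟨a, ha, s, ⟨z, hz, rfl⟩, rfl⟩ := hh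
    refine ⟨a, pA.admissible _ ha, z, hz, _, fun k => ?_, rfl⟩
    split_ifs <;> rfl
  next ht =>
    right
    refine ⟨ht, ?_⟩
    simp only [PMF.mem_support_bind_iff, PMF.support_map, Set.mem_image] at hh
    obtain ⟨d, hd, s, hs, rfl⟩ := hh
    cases d with
    | none =>
      simp only [defTrans, PMF.mem_support_pure_iff] at hs
      exact ⟨none, h.state.loc, fun k => Or.inl rfl, by rw [hs]⟩
    | some j =>
      simp only [defTrans, PMF.support_map, Set.mem_image] at hs
      obtain ⟨b, -, rfl⟩ := hs
      refine ⟨some j, _, fun k => ?_, rfl⟩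
      cases b with
      | false => exact Or.inl rfl
      | true =>
        by_cases hk : k = j
        · subst hk; right; simp
        · left; simp [hk]

/-- With a finite horizon, plays are not longer than the horizon. -/
theorem length_le_of_horizon {T : ℕ∞} (pD : G.DefStrategy) (pA : G.AdvStrategy) (t : ℕ) :
    ∀ h ∈ (law T pD pA t).support, (h.length : ℕ∞) ≤ T := by
  refine law_induction (fun m => by simp [History.length]) (fun h _ ho h' hh' => ?_) t
  have hlt : (h.length : ℕ∞) < T := not_le.1 fun hle => ho (Or.inr hle)
  have hl : h'.length = h.length + 1 := by
    rcases exists_of_mem_support_next hh' with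
      ⟨-, a, -, z, -, l, -, rfl⟩ | ⟨-, d, l, -, rfl⟩ <;> rfl
  rw [hl, Nat.cast_add, Nat.cast_one]
  exact Order.add_one_le_of_lt hlt

/-- The nodes from which a benign flow can still be reached, counted. -/
noncomputable def benignHeight (G : Game V W) (v : V) : ℕ :=
  {w | Relation.TransGen (fun u w => some w ∈ (G.piB u).support) v w}.ncard

/-- The nodes that the malicious flow has not visited. -/
def unvisited (h : History V W) : Set V :=
  {w | ∀ e ∈ h.advRecord, e.2.loc h.label ≠ Loc.node w}

/-- A bound for the remaining moves of a benign flow. -/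
noncomputable def benignPotential (G : Game V W) : Loc V → ℕ
  | Loc.source => Nat.card V + 1
  | Loc.node v => G.benignHeight v + 1
  | Loc.dropped => 0
  | Loc.trapped => 0

/-- A bound for the remaining moves of a malicious flow that has `n` nodes left to visit. -/
def maliciousPotential (n : ℕ) : Loc V → ℕ
  | Loc.source => n + 1
  | Loc.node _ => n + 1
  | Loc.dropped => 0
  | Loc.trapped => 0

open scoped Classical in
/-- A bound for the remaining moves of the flow `k`. -/
noncomputable def flowPotential (G : Game V W) (h : History V W) (k : Fin W) : ℕ :=
  if k = h.label then maliciousPotential (unvisited h).ncard (h.state.loc k)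
  else G.benignPotential (h.state.loc k)

/-- A bound for the remaining moves of all flows. -/
noncomputable def potential (G : Game V W) (h : History V W) : ℕ := ∑ k, G.flowPotential h k

section

variable [Finite V]

theorem benignHeight_lt_card (hG : G.BenignAcyclic) (v : V) : G.benignHeight v < Nat.card V := by
  rw [← Set.ncard_univ]
  exact Set.ncard_lt_ncard (Set.ssubset_univ_iff.2 fun h => hG v (Set.eq_univ_iff_forall.1 h v))

/-- What is reachable from `w` is reachable from `v`; by acyclicity `w` itself is reachable only
from `v`. -/
theorem benignHeight_lt (hG : G.BenignAcyclic) {v w : V} (hw : some w ∈ (G.piB v).support) :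
    G.benignHeight w < G.benignHeight v := by
  refine Set.ncard_lt_ncard ⟨fun x hx => Relation.TransGen.head hw hx, fun h => hG w ?_⟩
  exact h (Relation.TransGen.single hw)

omit [Finite V] in
theorem maliciousPotential_mono {m n : ℕ} (hmn : m ≤ n) (l : Loc V) :
    maliciousPotential m l ≤ maliciousPotential n l := by
  cases l <;> simp [maliciousPotential, hmn]

/-- A defender move does not increase the potential. -/
theorem potential_defMove_le (h : History V W) (d : Option (Fin W)) {l : Fin W → Loc V}
    (hl : ∀ k, l k = h.state.loc k ∨ l k = Loc.trapped) :
    G.potential (History.defMove h d ⟨Player.adversary, l⟩) ≤ G.potential h := by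
  classical
  have hu : (unvisited (History.defMove h d ⟨Player.adversary, l⟩)).ncard ≤
      (unvisited h).ncard := by
    refine Set.ncard_le_ncard fun w hw e he => hw e ?_
    exact List.mem_cons_of_mem _ he
  refine Finset.sum_le_sum fun k _ => ?_
  unfold flowPotential
  by_cases hk : k = h.label
  · rw [if_pos (show k = (History.defMove h d ⟨Player.adversary, l⟩).label from hk), if_pos hk]
    refine (maliciousPotential_mono hu _).trans ?_
    rcases hl k with h1 | h1
    · exact (congrArg _ h1).le
    · exact (congrArg _ h1).le.trans (Nat.zero_le _)
  · rw [if_neg (show k ≠ (History.defMove h d ⟨Player.adversary, l⟩).label from hk), if_neg hk]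
    rcases hl k with h1 | h1
    · exact (congrArg _ h1).le
    · exact (congrArg _ h1).le.trans (Nat.zero_le _)

omit [Finite V] in
theorem currentState_advRecord (h : History V W) : currentState h.advRecord = h.state := by
  cases h <;> rfl

/-- An adversary move in a nonabsorbing state decreases the potential. -/
theorem potential_advMove_lt (hG : G.BenignAcyclic) (h : History V W)
    (hna : ¬ G.Absorbing h.label h.state) {a : Option V} (ha : a ∈ G.advActions h.advInfo)
    {z : Fin W → Option V} (hz : z ∈ (G.benign h.label h.state.loc a).support)
    {l : Fin W → Loc V}
    (hl : ∀ k, l k = if k = h.label then Loc.ofMove a else Loc.ofMove (z k)) :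
    G.potential (History.advMove h a ⟨Player.defender, l⟩) < G.potential h := by
  classical
  simp only [Absorbing, not_or, not_exists, not_forall] at hna
  -- No flow is trapped and some flow `k₀` has not dropped out. Every such flow strictly loses
  -- potential, and dropped flows gain none.
  obtain ⟨-, htr, k₀, hk₀⟩ := hna
  set h' := History.advMove h a ⟨Player.defender, l⟩ with hh'
  have hlab : h'.label = h.label := rfl
  have hloc : ∀ k, h'.state.loc k = l k := fun k => rfl
  have key : ∀ k, G.flowPotential h' k ≤ G.flowPotential h k ∧
      (h.state.loc k ≠ Loc.dropped → G.flowPotential h' k < G.flowPotential h k) := by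
    intro k
    unfold flowPotential
    rw [hlab, hloc]
    by_cases hk : k = h.label
    · rw [if_pos hk, if_pos hk, hl k, if_pos hk]
      cases a with
      | none =>
        refine ⟨Nat.zero_le _, fun hd => ?_⟩
        change 0 < _
        cases hc : h.state.loc k with
        | source => exact Nat.succ_pos _
        | node v => exact Nat.succ_pos _
        | dropped => exact absurd hc hd
        | trapped => exact absurd hc (htr k)
      | some w =>
        obtain ⟨hs, hv⟩ := ha w rfl
        -- The node `w` was unvisited and is now visited.
        have hlt : (unvisited h').ncard < (unvisited h).ncard := by
          refine Set.ncard_lt_ncard ⟨fun x hx e he => hx e (List.mem_cons_of_mem _ he),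
            fun hsub => ?_⟩
          refine hsub (show w ∈ unvisited h from hv) (some (some w), ⟨Player.defender, l⟩)
            List.mem_cons_self ?_
          change l h.label = Loc.node w
          rw [hl, if_pos rfl, Loc.ofMove]
        have hs' : G.Succ (h.state.loc k) w := by
          rw [hk, ← currentState_advRecord]; exact hs
        have : maliciousPotential (unvisited h').ncard (Loc.ofMove (some w)) <
            maliciousPotential (unvisited h).ncard (h.state.loc k) := by
          change (unvisited h').ncard + 1 < _
          cases hc : h.state.loc k with
          | source => exact Nat.succ_lt_succ hlt
          | node v => exact Nat.succ_lt_succ hlt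
          | dropped => rw [hc] at hs'; exact hs'.elim
          | trapped => rw [hc] at hs'; exact hs'.elim
        exact ⟨this.le, fun _ => this⟩
    · rw [if_neg hk, if_neg hk, hl k, if_neg hk]
      cases hc : h.state.loc k with
      | source =>
        -- The first node is arbitrary, so the potential of the source has to exceed that of every
        -- node.
        have : G.benignPotential (Loc.ofMove (z k)) < G.benignPotential Loc.source := by
          cases z k with
          | none => exact Nat.succ_pos _
          | some w => exact Nat.succ_lt_succ (benignHeight_lt_card hG w)
        exact ⟨this.le, fun _ => this⟩
      | node v =>
        have hzk := G.benign_node _ _ _ z hz k hk v hc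
        have : G.benignPotential (Loc.ofMove (z k)) < G.benignPotential (Loc.node v) := by
          cases hw : z k with
          | none => exact Nat.succ_pos _
          | some w => exact Nat.succ_lt_succ (benignHeight_lt hG (hw ▸ hzk))
        exact ⟨this.le, fun _ => this⟩
      | dropped =>
        rw [G.benign_dropped _ _ _ z hz k hk hc]
        exact ⟨le_rfl, fun hd => (hd rfl).elim⟩
      | trapped => exact absurd hc (htr k)
  exact Finset.sum_lt_sum (fun k _ => (key k).1) ⟨k₀, Finset.mem_univ _, (key k₀).2 hk₀⟩

theorem length_le_of_benignAcyclic (hG : G.BenignAcyclic) {T : ℕ∞} (pD : G.DefStrategy)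
    (pA : G.AdvStrategy) (t : ℕ) :
    ∀ h ∈ (law T pD pA t).support, h.length ≤ 2 * (W * (Nat.card V + 1)) := by
  classical
  -- A unit of potential pays for two steps, an adversary move and the defender's reply; the extra
  -- `1` is the reply still due.
  have hinv : ∀ h ∈ (law T pD pA t).support, h.length + 2 * G.potential h +
      (match h.state.turn with | .defender => 1 | .adversary => 0) ≤ 2 * (W * (Nat.card V + 1)) := by
    refine law_induction (fun m => ?_) (fun h hi ho h' hh' => ?_) t
    · have : ∀ k, G.flowPotential (History.start m) k = Nat.card V + 1 := by
        intro k
        simp [flowPotential, History.state, State.init, maliciousPotential, benignPotential,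
          unvisited, History.advRecord]
      simp [potential, this, History.length, History.state, State.init]
    · rcases exists_of_mem_support_next hh' with
        ⟨ht, a, ha, z, hz, l, hl, rfl⟩ | ⟨ht, d, l, hl, rfl⟩
      · have := potential_advMove_lt hG h (fun hab => ho (Or.inl hab)) ha hz hl
        simp only [ht] at hi
        change h.length + 1 + 2 * _ + 1 ≤ _
        omega
      · have := potential_defMove_le (G := G) h d hl
        simp only [ht] at hi
        change h.length + 1 + 2 * _ + 0 ≤ _
        omega
  intro h hh
  have := hinv h hh
  omega

/-- In a game with finite horizon or without benign cycles the length of the plays is bounded. -/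
theorem exists_length_bound {T : ℕ∞} (hT : T ≠ ⊤ ∨ G.BenignAcyclic) :
    ∃ N : ℕ, ∀ (pD : G.DefStrategy) (pA : G.AdvStrategy) (t : ℕ),
      ∀ h ∈ (law T pD pA t).support, h.length ≤ N := by
  rcases hT with hT | hG
  · obtain ⟨N, rfl⟩ := ENat.ne_top_iff_exists.1 hT
    exact ⟨N, fun pD pA t h hh => by exact_mod_cast length_le_of_horizon pD pA t h hh⟩
  · exact ⟨_, fun pD pA t => length_le_of_benignAcyclic hG pD pA t⟩

end

end Game

/-! ### Payoffs in sequence form and the equilibrium. -/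

namespace Game

variable {V : Type*} {W : ℕ} {G : Game V W}

/-- Evaluation of a realization plan at a record. -/
def planEval {L R : Type*} (l : L) (y : R) : (L → R → ℝ) →L[ℝ] ℝ :=
  (ContinuousLinearMap.proj y).comp (ContinuousLinearMap.proj (R := ℝ) (φ := fun _ : L => R → ℝ) l)

theorem planEval_apply {L R : Type*} (l : L) (y : R) (x : L → R → ℝ) :
    planEval l y x = x l y := rfl

/-- The admissible defender actions as a function of the (trivial) label and the record. -/
def defAdm (G : Game V W) : Unit → DefInfo V W → Set (Option (Fin W)) := fun _ => G.defActions

/-- The admissible adversary actions as a function of the malicious index and the record. -/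
def advAdm (G : Game V W) :
    Fin W → List (Option (Option V) × State V W) → Set (Option V) :=
  fun m y => G.advActions ⟨m, y⟩

theorem none_mem_defActions (y : DefInfo V W) : none ∈ G.defActions y := fun _ h => nomatch h

theorem none_mem_advActions (z : AdvInfo V W) : none ∈ G.advActions z := fun _ h => nomatch h

theorem isPlan_defPlan (pD : G.DefStrategy) : IsPlan G.defAdm pD.plan :=
  isPlan_reach fun _ => pD.admissible

theorem exists_defPlan_eq {x : Unit → DefInfo V W → ℝ} (hx : IsPlan G.defAdm x) :
    ∃ pD : G.DefStrategy, pD.plan = x := by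
  have : Nonempty (State V W) := ⟨State.init V W⟩
  obtain ⟨p, hp, rfl⟩ := hx.exists_reach_eq fun _ y => ⟨none, none_mem_defActions y⟩
  exact ⟨⟨p (), hp ()⟩, rfl⟩

variable [Fintype V]

theorem isPlan_advPlan (pA : G.AdvStrategy) : IsPlan G.advAdm pA.plan :=
  isPlan_reach fun m y => pA.admissible ⟨m, y⟩

theorem exists_advPlan_eq {x : Fin W → List (Option (Option V) × State V W) → ℝ}
    (hx : IsPlan G.advAdm x) : ∃ pA : G.AdvStrategy, pA.plan = x := by
  have : Nonempty (State V W) := ⟨State.init V W⟩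
  obtain ⟨p, hp, rfl⟩ := hx.exists_reach_eq fun m y => ⟨none, none_mem_advActions ⟨m, y⟩⟩
  exact ⟨⟨fun z => p z.label z.record, fun z => hp z.label z.record⟩, rfl⟩

/-- An expectation whose integrand is, after weighting with the defender's realization probability,
linear in the defender's realization plan has finite rank in the realization plans. -/
theorem exists_sum_law (T : ℕ∞) (t : ℕ) (F : G.DefStrategy → History V W → ℝ)
    (hF : ∀ h, ∃ f : (Unit → DefInfo V W → ℝ) →L[ℝ] ℝ, ∀ pD : G.DefStrategy,
      F pD h * pD.plan () h.defInfo = f pD.plan) :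
    ∃ (s : Finset (History V W)) (f : History V W → (Unit → DefInfo V W → ℝ) →L[ℝ] ℝ),
      ∀ (pD : G.DefStrategy) (pA : G.AdvStrategy), expect (law T pD pA t) (F pD) =
        ∑ h ∈ s, f h pD.plan * planEval h.label h.advRecord pA.plan := by
  choose f hf using hF
  obtain ⟨c, hc⟩ := hasRep_law (G := G) T t
  refine ⟨c.support, fun h => c h • f h, fun pD pA => (hc pD pA _).trans ?_⟩
  refine Finset.sum_congr rfl fun h _ => ?_
  rw [smul_apply, ← hf, planEval_apply, smul_eq_mul]
  ring

/-- The expected analysis cost depends on the defender's strategy as well, but an action probability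
times the `reach` of the record is the plan at the extended record, so linearity in the plan
persists. -/
theorem exists_sum_stageD (T : ℕ∞) (t : ℕ) :
    ∃ (s : Finset (History V W)) (f : History V W → (Unit → DefInfo V W → ℝ) →L[ℝ] ℝ),
      ∀ (pD : G.DefStrategy) (pA : G.AdvStrategy), stageD T pD pA t =
        ∑ h ∈ s, f h pD.plan * planEval h.label h.advRecord pA.plan := by
  classical
  refine exists_sum_law T t _ fun h => ?_
  by_cases hl : h.length = t
  · by_cases ho : G.Over T h
    · refine ⟨G.endPayoff G.alphaD G.betaD h.label h.state • planEval () h.defInfo, fun pD => ?_⟩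
      simp [hl, ho, planEval_apply]
    · cases ht : h.state.turn with
      | adversary => exact ⟨0, fun pD => by simp [hl, ho]⟩
      | defender =>
        refine ⟨∑ d, G.actionCost h.state d •
          planEval () ((some d, State.init V W) :: h.defInfo), fun pD => ?_⟩
        simp only [hl, ho, if_true, if_false, expect_fintype, sum_apply,
          smul_apply, planEval_apply, Finset.sum_mul, smul_eq_mul]
        refine Finset.sum_congr rfl fun d _ => ?_
        simp only [DefStrategy.plan, reach]
        ring
  · exact ⟨0, fun pD => by simp [hl]⟩

theorem exists_sum_stageA (T : ℕ∞) (t : ℕ) :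
    ∃ (s : Finset (History V W)) (f : History V W → (Unit → DefInfo V W → ℝ) →L[ℝ] ℝ),
      ∀ (pD : G.DefStrategy) (pA : G.AdvStrategy), stageA T pD pA t =
        ∑ h ∈ s, f h pD.plan * planEval h.label h.advRecord pA.plan := by
  classical
  refine exists_sum_law T t _ fun h => ⟨(if h.length = t ∧ G.Over T h then
    G.endPayoff G.alphaA G.betaA h.label h.state else 0) • planEval () h.defInfo, fun pD => ?_⟩
  rw [smul_apply, planEval_apply, smul_eq_mul]

omit [Fintype V] in
/-- Payoffs that are finite sums of expected stage payoffs have finite rank. -/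
theorem exists_isFiniteRank {σ : G.DefStrategy → G.AdvStrategy → ℕ → ℝ} (N : ℕ)
    (hσ : ∀ t, ∃ (s : Finset (History V W))
      (f : History V W → (Unit → DefInfo V W → ℝ) →L[ℝ] ℝ),
      ∀ (pD : G.DefStrategy) (pA : G.AdvStrategy), σ pD pA t =
        ∑ h ∈ s, f h pD.plan * planEval h.label h.advRecord pA.plan) :
    ∃ u : (Unit → DefInfo V W → ℝ) → (Fin W → List (Option (Option V) × State V W) → ℝ) → ℝ,
      IsFiniteRank u ∧ ∀ pD pA, ∑ t ∈ Finset.range N, σ pD pA t = u pD.plan pA.plan := by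
  choose s f hf using hσ
  refine ⟨_, isFiniteRank_sum ((Finset.range N).sigma s) (fun i => f i.1 i.2)
    fun i => planEval i.2.label i.2.advRecord, fun pD pA => ?_⟩
  rw [Finset.sum_sigma]
  exact Finset.sum_congr rfl fun t _ => hf t pD pA

/-- The expected stage payoffs vanish after finitely many steps, uniformly in the strategies. -/
theorem exists_stage_eq_zero {T : ℕ∞} (hT : T ≠ ⊤ ∨ G.BenignAcyclic) :
    ∃ N : ℕ, ∀ (pD : G.DefStrategy) (pA : G.AdvStrategy), ∀ t ∉ Finset.range N,
      stageD T pD pA t = 0 ∧ stageA T pD pA t = 0 := by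
  obtain ⟨N, hN⟩ := exists_length_bound hT
  refine ⟨N + 1, fun pD pA t ht => ?_⟩
  have hne : ∀ h ∈ (law T pD pA t).support, h.length ≠ t := by
    intro h hh hl
    have := hN pD pA t h hh
    simp only [Finset.mem_range] at ht
    omega
  exact ⟨expect_eq_zero fun h hh => if_neg (hne h hh),
    expect_eq_zero fun h hh => if_neg fun hc => hne h hh hc.1⟩

/-- The game has a Nash equilibrium in behavioral strategies. -/
theorem exists_isNash {T : ℕ∞} (hT : T ≠ ⊤ ∨ G.BenignAcyclic) :
    ∃ (pD : G.DefStrategy) (pA : G.AdvStrategy), IsNash T pD pA := by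
  obtain ⟨N, hN⟩ := exists_stage_eq_zero hT
  obtain ⟨u, hu, hUu⟩ := exists_isFiniteRank (G := G) N (exists_sum_stageD T)
  obtain ⟨v, hv, hUv⟩ := exists_isFiniteRank (G := G) N (exists_sum_stageA T)
  have hUD : ∀ (pD : G.DefStrategy) (pA : G.AdvStrategy),
      payoffD T pD pA = u pD.plan pA.plan := fun pD pA => by
    rw [← hUu, payoffD, tsum_eq_sum fun t ht => (hN pD pA t ht).1]
  have hUA : ∀ (pD : G.DefStrategy) (pA : G.AdvStrategy),
      payoffA T pD pA = v pD.plan pA.plan := fun pD pA => by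
    rw [← hUv, payoffA, tsum_eq_sum fun t ht => (hN pD pA t ht).2]
  -- These two strategies only witness that the sets of plans are nonempty.
  let dropAll : G.AdvStrategy := ⟨fun _ => PMF.pure none, fun z a ha => by
    rw [(PMF.mem_support_pure_iff _ _).1 ha]; exact none_mem_advActions z⟩
  let noAnalysis : G.DefStrategy := ⟨fun _ => PMF.pure none, fun y d hd => by
    rw [(PMF.mem_support_pure_iff _ _).1 hd]; exact none_mem_defActions y⟩
  obtain ⟨x, hx, y, hy, hxu, hyv⟩ := exists_bilinear_equilibrium
    ⟨_, isPlan_defPlan noAnalysis⟩ ⟨_, isPlan_advPlan dropAll⟩ (isCompact_setOf_isPlan G.defAdm)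
    (isCompact_setOf_isPlan G.advAdm) (convex_setOf_isPlan G.defAdm)
    (convex_setOf_isPlan G.advAdm) hu hv
  obtain ⟨pD, rfl⟩ := exists_defPlan_eq hx
  obtain ⟨pA, rfl⟩ := exists_advPlan_eq hy
  -- Payoffs depend on strategies only through their plans, and every deviation has a plan.
  refine ⟨pD, pA, fun qD => ?_, fun qA => ?_⟩
  · rw [hUD, hUD]; exact hxu _ (isPlan_defPlan qD)
  · rw [hUA, hUA]; exact hyv _ (isPlan_advPlan qA)

end Game

end AptDift

theorem mainTheorem4 {V : Type*} [Fintype V] {W : ℕ} (G : AptDift.Game V W) (T : ℕ∞)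
    (hT : T ≠ ⊤ ∨ G.BenignAcyclic) :
    (∀ (pD : G.DefStrategy) (pA : G.AdvStrategy),
      Summable (AptDift.Game.stageD T pD pA) ∧ Summable (AptDift.Game.stageA T pD pA)) ∧
    ∃ (pD : G.DefStrategy) (pA : G.AdvStrategy), AptDift.Game.IsNash T pD pA := by
  obtain ⟨N, hN⟩ := AptDift.Game.exists_stage_eq_zero hT
  exact ⟨fun pD pA => ⟨summable_of_ne_finset_zero fun t ht => (hN pD pA t ht).1,
    summable_of_ne_finset_zero fun t ht => (hN pD pA t ht).2⟩, AptDift.Game.exists_isNash hT⟩
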